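/- Let $\mathsf A$ be an abelian category, let $Q=(Q_0,Q_1)$ be a quiver with $Q_0\neq\emptyset$, and let $\mathsf X$ be a full additive subcategory of $\mathsf A$ closed under isomorphisms. **Conventions.** Put $\mathsf X^\perp=\{M : \mathrm{Ext}^1_{\mathsf A}(X,M)=0 \text{ for all } X\in\mathsf X\}$ and ${}^\perp\mathsf X=\{M : \mathrm{Ext}^1_{\mathsf A}(M,X)=0\text{ for all }X\in\mathsf X\}$. A pair $(\mathsf U,\mathsf V)$ of classes of objects of an abelian category is a *cotorsion pair* if $\mathsf U^\perp=\mathsf V$ and ${}^\perp\mathsf V=\mathsf U$; it is *complete* if for every object $M$ there are an epimorphism $U\to M$ with $U\in\mathsf U$ and kernel in $\mathsf U^\perp$, and a monomorphism $M\to V$ with $V\in\mathsf V$ and cokernel in ${}^\perp\mathsf V$. Let $\mathrm{Rep}(Q,\mathsf A)$ be the abelian category of $\mathsf A$-valued representations of $Q$, and let $\mathrm{Rep}(Q,\mathsf X)$ be the class of representations $R$ with $R(i)\in\mathsf X$ for all $i\in Q_0$. For $R\in\mathrm{Rep}(Q,\mathsf A)$ and $i\in Q_0$, the arrows with target $i$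 (respectively, source $i$) induce the canonical morphisms $$\varphi_i^R:\bigoplus_{a:\,j\to i}R(j)\to R(i),\qquad \psi_i^R:R(i)\to\prod_{a:\,i\to j}R(j)$$ whenever these coproducts (respectively, products) exist. Let $\Phi(\mathsf X)$ be the class of all $R$ such that for every $i\in Q_0$ the morphism $\varphi_i^R$ is a monomorphism with cokernel in $\mathsf X$, and let $\Psi(\mathsf X)$ be the class of all $R$ such that for every $i\in Q_0$ the morphism $\psi_i^R$ is an epimorphism with kernel in $\mathsf X$. Define sets of vertices by transfinite recursion: $V_0=\emptyset$; $V_{\alpha+1}$ is the set of vertices $i$ such that every arrow with target $i$ has its source in $\bigcup_{\beta\le\alpha}V_\beta$; and $V_\alpha=\bigcup_{\beta<\alpha}V_\beta$ for a limit ordinal $\alpha$. The quiver $Q$ is *left rooted* if $V_\lambda=Q_0$ for some ordinal $\lambda$, and *right rooted* if the opposite quiver $Q^{\mathrm{op}}$ is left rooted. The category $\mathsf A$ satisfies AB4 if it has all small coproducts and they are exact, and AB4* if it has all small products and they are exact. **Statement.** (a) Suppose that $\mathsf A$ satisfies AB4 and $Q$ is left rooted. Then $(\mathsf X,\mathsf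 X^\perp)$ is a complete cotorsion pair in $\mathsf A$ if and only if $(\Phi(\mathsf X),\mathrm{Rep}(Q,\mathsf X^\perp))$ is a complete cotorsion pair in $\mathrm{Rep}(Q,\mathsf A)$ and $\mathsf X$ is closed under extensions and small coproducts. (b) Suppose that $\mathsf A$ satisfies AB4* and $Q$ is right rooted. Then $({}^\perp\mathsf X,\mathsf X)$ is a complete cotorsion pair in $\mathsf A$ if and only if $(\mathrm{Rep}(Q,{}^\perp\mathsf X),\Psi(\mathsf X))$ is a complete cotorsion pair in $\mathrm{Rep}(Q,\mathsf A)$ and $\mathsf X$ is closed under extensions and small products. -/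

import Mathlib

open CategoryTheory CategoryTheory.Limits

universe w v u

/-! ### Cotorsion pairs in an abelian category -/

section Cotorsion

variable {C : Type u} [Category.{v} C] [Abelian C]

/-- `Ext¹(X, Y) = 0`. The groups `Ext` are Mathlib's (morphisms `X ⟶ Y⟦1⟧` in the derived
category), taken in the universe where they always exist. -/
def ExtOneVanishes (X Y : C) : Prop :=
  haveI : HasExt.{max u v} C := HasExt.standard C
  Subsingleton (Abelian.Ext.{max u v} X Y 1)

/-- `P^⊥`: the objects `M` with `Ext¹(X, M) = 0` for all `X` in `P`. -/
def rightPerp (P : ObjectProperty C) : ObjectProperty C :=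
  fun M => ∀ X : C, P X → ExtOneVanishes X M

/-- `^⊥P`: the objects `M` with `Ext¹(M, X) = 0` for all `X` in `P`. -/
def leftPerp (P : ObjectProperty C) : ObjectProperty C :=
  fun M => ∀ X : C, P X → ExtOneVanishes M X

/-- `f : X ⟶ M` is a special `P`-precover of `M`. -/
structure IsSpecialPrecover (P : ObjectProperty C) {X M : C} (f : X ⟶ M) : Prop where
  epi : Epi f
  mem : P X
  kernel_mem : rightPerp P (kernel f)

/-- `g : M ⟶ Y` is a special `P`-preenvelope of `M`. -/
structure IsSpecialPreenvelope (P : ObjectProperty C) {M Y : C} (g : M ⟶ Y) : Prop where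
  mono : Mono g
  mem : P Y
  cokernel_mem : leftPerp P (cokernel g)

/-- `(P, R)` is a cotorsion pair. -/
structure IsCotorsionPair (P R : ObjectProperty C) : Prop where
  rightPerp_eq : rightPerp P = R
  leftPerp_eq : leftPerp R = P

/-- `(P, R)` is a complete cotorsion pair: every object has a special `P`-precover and a special
`R`-preenvelope. -/
structure IsCompleteCotorsionPair (P R : ObjectProperty C) : Prop extends
    IsCotorsionPair P R where
  exists_precover : ∀ M : C, ∃ (X : C) (f : X ⟶ M), IsSpecialPrecover P f
  exists_preenvelope : ∀ M : C, ∃ (Y : C) (g : M ⟶ Y), IsSpecialPreenvelope R g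

end Cotorsion

/-! ### Rooted quivers -/

section Rooted

/-- The transfinite sequence of sets of vertices with `V₀ = ∅`,
`V_{β+1} = {i | every arrow with target i has its source in ⋃_{γ ≤ β} V_γ}`, and
`V_α = ⋃_{β < α} V_β` for limit ordinals `α` (see the three lemmas below). -/
def rootedSeq (V : Type u) [Quiver.{v} V] (α : Ordinal.{u}) : Set V :=
  {i | (∃ β, ∃ _ : α = Order.succ β, ∀ (j : V), (j ⟶ i) → ∃ γ, ∃ _ : γ ≤ β, j ∈ rootedSeq V γ) ∨
    (Order.IsSuccLimit α ∧ ∃ β, ∃ _ : β < α, i ∈ rootedSeq V β)}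
termination_by α
decreasing_by
  · subst_vars
    exact Order.lt_succ_of_le ‹_›
  · assumption

variable (V : Type u) [Quiver.{v} V]

theorem rootedSeq_zero : rootedSeq V 0 = ∅ := by
  ext i
  rw [rootedSeq]
  simp only [Set.mem_ofPred_eq, Set.mem_empty_iff_false, iff_false, not_or]
  refine ⟨?_, ?_⟩
  · rintro ⟨β, h, -⟩
    exact (Order.bot_lt_succ β).ne h
  · rintro ⟨-, β, h, -⟩
    exact not_lt_bot h

theorem rootedSeq_succ (β : Ordinal.{u}) :
    rootedSeq V (Order.succ β) = {i | ∀ (j : V), (j ⟶ i) → j ∈ ⋃ γ ≤ β, rootedSeq V γ} := by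
  ext i
  rw [rootedSeq]
  simp only [Set.mem_ofPred_eq, Set.mem_iUnion]
  refine ⟨?_, fun h => Or.inl ⟨β, rfl, h⟩⟩
  rintro (⟨β', h, h'⟩ | ⟨h, -⟩)
  · obtain rfl := Order.succ_injective h
    exact h'
  · exact absurd h (Order.not_isSuccLimit_succ β)

theorem rootedSeq_limit {α : Ordinal.{u}} (hα : Order.IsSuccLimit α) :
    rootedSeq V α = ⋃ β < α, rootedSeq V β := by
  ext i
  rw [rootedSeq]
  simp only [Set.mem_ofPred_eq, Set.mem_iUnion]
  refine ⟨?_, fun h => Or.inr ⟨hα, h⟩⟩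
  rintro (⟨β', rfl, -⟩ | ⟨-, h⟩)
  · exact absurd hα (Order.not_isSuccLimit_succ β')
  · exact h

/-- A quiver is left rooted if `V_α` consists of all the vertices for some ordinal `α`. -/
def IsLeftRooted : Prop := ∃ α : Ordinal.{u}, rootedSeq V α = Set.univ

/-- A quiver is right rooted if the opposite quiver is left rooted. -/
def IsRightRooted : Prop := IsLeftRooted Vᵒᵖ

end Rooted

/-! ### Representations of a quiver -/

section Representations

/-- The category of `A`-valued representations of the quiver `V`, as functors on the free (path)
category of `V`; such a functor is the same as a choice of objects for the vertices and of
morphisms for the arrows. -/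
abbrev QuiverRep (V : Type w) [Quiver.{w} V] (A : Type u) [Category.{v} A] :=
  Paths V ⥤ A

variable {V : Type w} [Quiver.{w} V] {A : Type u} [Category.{v} A]

namespace QuiverRep

/-- The object of `A` at the vertex `i`. -/
abbrev vertexObj (X : QuiverRep V A) (i : V) : A := X.obj ((Paths.of V).obj i)

/-- The morphism of `A` attached to the arrow `a`. -/
abbrev arrow (X : QuiverRep V A) {i j : V} (a : i ⟶ j) : X.vertexObj i ⟶ X.vertexObj j :=
  X.map ((Paths.of V).map a)

/-- The canonical morphism `φᵢ : ⨁_{a : j ⟶ i} X(j) ⟶ X(i)`, over all arrows with target `i`. -/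
noncomputable def phi [HasCoproducts.{w} A] (X : QuiverRep V A) (i : V) :
    (∐ fun a : (Σ j : V, (j ⟶ i)) => X.vertexObj a.1) ⟶ X.vertexObj i :=
  Sigma.desc fun a => X.arrow a.2

/-- The canonical morphism `ψᵢ : X(i) ⟶ ∏_{a : i ⟶ j} X(j)`, over all arrows with source `i`. -/
noncomputable def psi [HasProducts.{w} A] (X : QuiverRep V A) (i : V) :
    X.vertexObj i ⟶ ∏ᶜ fun a : (Σ j : V, (i ⟶ j)) => X.vertexObj a.1 :=
  Pi.lift fun a => X.arrow a.2

end QuiverRep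

variable (V)

/-- `Rep(Q, P)`: the representations with values in `P`. -/
def repIn (P : ObjectProperty A) : ObjectProperty (QuiverRep V A) :=
  fun X => ∀ i : V, P (X.vertexObj i)

variable [Abelian A]

/-- `Φ(P)`: for every vertex `i`, `φᵢ` is a monomorphism with cokernel in `P`. -/
def Phi [HasCoproducts.{w} A] (P : ObjectProperty A) : ObjectProperty (QuiverRep V A) :=
  fun X => ∀ i : V, Mono (X.phi i) ∧ P (cokernel (X.phi i))

/-- `Ψ(P)`: for every vertex `i`, `ψᵢ` is an epimorphism with kernel in `P`. -/
def Psi [HasProducts.{w} A] (P : ObjectProperty A) : ObjectProperty (QuiverRep V A) :=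
  fun X => ∀ i : V, Epi (X.psi i) ∧ P (kernel (X.psi i))

end Representations

/-! Left rootedness makes the relation `Nonempty (j ⟶ i)` well founded, so sections and
factorizations of representations can be built vertex by vertex, and the step at `i` is a problem in
`A` about φᵢ. The tool in `A` is lifting: a monomorphism lifts against an epimorphism as soon as
Ext¹(coker, ker) = 0 (`hasLiftingProperty_of_extOneVanishes`). Lifting φᵢ at each vertex shows that
Ext¹ vanishes between Φ(X) and Rep(Q, X^⊥) (`extOneVanishes_of_Phi`).

Completeness is obtained as in the theory of Reedy model structures. A complete cotorsion pair
factors each morphism of `A` as a monomorphism with cokernel in X followed by an epimorphism with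
kernel in X^⊥. Applied at each vertex relative to the coproduct over incoming arrows, this factors
morphisms of representations (`exists_rep_factorization`). Factoring 0 → M and M → 0 yields special
precovers and preenvelopes, and a retract argument places ^⊥Rep(Q, X^⊥) inside Φ(X). The left
adjoint of evaluation at `i`, which preserves monomorphisms by AB4, places Φ(X)^⊥ inside Rep(Q,
X^⊥).

Conversely, a minimal vertex receives no arrows, so there φᵢ starts at a zero object and members of
Φ(X) take values in X; evaluating at that vertex recovers the pair in `A`. Part (b) is part (a) for
the opposite quiver and category, through Rep(Q, A)ᵒᵖ ≌ Rep(Qᵒᵖ, Aᵒᵖ). -/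

open Opposite
open scoped ZeroObject

/-! ### Vanishing of Ext¹ as splitting of short exact sequences -/

section ExtOne

variable {C : Type u} [Category.{v} C] [Abelian C]

open Pretriangulated DerivedCategory in
/-- Every morphism `X ⟶ Y⟦1⟧` in the derived category is killed by the epimorphism of a short exact
sequence `0 ⟶ Y ⟶ E ⟶ X ⟶ 0`. -/
theorem exists_shortExact_comp_eq_zero [HasDerivedCategory.{w} C] {X Y : C}
    (α : (singleFunctor C 0).obj X ⟶ ((singleFunctor C 0).obj Y)⟦(1 : ℤ)⟧) :
    ∃ (E : C) (i : Y ⟶ E) (p : E ⟶ X) (w : i ≫ p = 0),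
      (ShortComplex.mk i p w).ShortExact ∧ (singleFunctor C 0).map p ≫ α = 0 := by
  -- Complete `α` to a triangle Y → Z → X → Y⟦1⟧. By the long homology sequence `Z` is concentrated
  -- in degree 0, hence comes from an object `E`.
  obtain ⟨Z, f, g, hT⟩ := Pretriangulated.distinguished_cocone_triangle₂ α
  have hX (n : ℤ) (hn : n ≠ 0) : IsZero ((homologyFunctor C n).obj ((singleFunctor C 0).obj X)) := by
    rcases lt_or_gt_of_ne hn with h | h
    · exact isZero_of_isGE _ 0 n h
    · exact isZero_of_isLE _ 0 n h
  have hY (n : ℤ) (hn : n ≠ 0) : IsZero ((homologyFunctor C n).obj ((singleFunctor C 0).obj Y)) := by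
    rcases lt_or_gt_of_ne hn with h | h
    · exact isZero_of_isGE _ 0 n h
    · exact isZero_of_isLE _ 0 n h
  have hZ (n : ℤ) (hn : n ≠ 0) : IsZero ((homologyFunctor C n).obj Z) :=
    (HomologySequence.exact₂ _ hT n).isZero_of_both_zeros
      ((hY n hn).eq_of_src _ _) ((hX n hn).eq_of_tgt _ _)
  have : Z.IsGE 0 := (isGE_iff _ _).2 fun i hi => hZ i hi.ne
  have : Z.IsLE 0 := (isLE_iff _ _).2 fun i hi => hZ i hi.ne'
  obtain ⟨E, ⟨e⟩⟩ := exists_iso_singleFunctor_obj_of_isGE_of_isLE Z 0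
  obtain ⟨i, hi⟩ := (singleFunctor C 0).map_surjective (f ≫ e.hom)
  obtain ⟨p, hp⟩ := (singleFunctor C 0).map_surjective (e.inv ≫ g)
  have hT' : Triangle.mk ((singleFunctor C 0).map i) ((singleFunctor C 0).map p) α ∈
      distTriang (DerivedCategory C) := by
    refine isomorphic_distinguished _ hT _ (Triangle.isoMk _ _ (Iso.refl _) e.symm (Iso.refl _) ?_ ?_ ?_)
    · change (singleFunctor C 0).map i ≫ e.inv = 𝟙 ((singleFunctor C 0).obj Y) ≫ f
      simp [hi]
    · change (singleFunctor C 0).map p ≫ 𝟙 ((singleFunctor C 0).obj X) = e.inv ≫ g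
      simp [hp]
    · change α ≫ (𝟙 ((singleFunctor C 0).obj Y))⟦(1 : ℤ)⟧' = 𝟙 ((singleFunctor C 0).obj X) ≫ α
      simp
  have w : i ≫ p = 0 := (singleFunctor C 0).map_injective <| by
    rw [Functor.map_comp, Functor.map_zero]
    exact comp_distTriang_mor_zero₁₂ _ hT'
  refine ⟨E, i, p, w, ?_, comp_distTriang_mor_zero₂₃ _ hT'⟩
  -- H⁰ of the triangle is the desired sequence: it is left exact since H⁻¹(X) = 0 and right exact
  -- since H¹(Y) = 0.
  let φ := singleFunctorCompHomologyFunctorIso C 0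
  have hm := (HomologySequence.mono_homologyMap_mor₁_iff _ hT' (-1) 0).2
    ((hX (-1) (by simp)).eq_of_src _ _)
  have he := (HomologySequence.epi_homologyMap_mor₂_iff _ hT' 0 1).2
    ((hY 1 (by simp)).eq_of_tgt _ _)
  have hex := HomologySequence.exact₂ _ hT' 0
  exact
    { exact := (ShortComplex.exact_iff_of_iso (ShortComplex.isoMk (φ.app Y) (φ.app E) (φ.app X)
        (φ.hom.naturality i).symm (φ.hom.naturality p).symm)).1 hex
      mono_f := ((MorphismProperty.monomorphisms C).arrow_mk_iso_iff
        (Arrow.isoMk (φ.app Y) (φ.app E) (φ.hom.naturality i).symm)).1 hm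
      epi_g := ((MorphismProperty.epimorphisms C).arrow_mk_iso_iff
        (Arrow.isoMk (φ.app E) (φ.app X) (φ.hom.naturality p).symm)).1 he }

/-- `Ext¹(X, Y) = 0` if and only if all short exact sequences `0 ⟶ Y ⟶ E ⟶ X ⟶ 0` split. -/
theorem extOneVanishes_iff {X Y : C} : ExtOneVanishes X Y ↔
    ∀ ⦃E : C⦄ (i : Y ⟶ E) (p : E ⟶ X) (w : i ≫ p = 0), (ShortComplex.mk i p w).ShortExact →
      ∃ s : X ⟶ E, s ≫ p = 𝟙 X := by
  let : HasExt.{max u v} C := HasExt.standard C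
  let := HasDerivedCategory.standard C
  refine ⟨fun (h : Subsingleton (Abelian.Ext.{max u v} X Y 1)) E i p w hS => ?_, fun h => ?_⟩
  · obtain ⟨s, hs⟩ := Abelian.Ext.covariant_sequence_exact₃ X hS (Abelian.Ext.mk₀ (𝟙 X))
      (zero_add 1) (Subsingleton.elim _ _)
    obtain ⟨s, rfl⟩ := (Abelian.Ext.mk₀_bijective _ _).2 s
    refine ⟨s, (Abelian.Ext.mk₀_bijective _ _).1 ?_⟩
    rw [← hs, Abelian.Ext.mk₀_comp_mk₀]
  · have key (α : Abelian.Ext.{max u v} X Y 1) : α = 0 := by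
      obtain ⟨E, i, p, w, hS, hα⟩ := exists_shortExact_comp_eq_zero α.hom
      obtain ⟨s, hs⟩ := h i p w hS
      apply Abelian.Ext.ext
      rw [Abelian.Ext.zero_hom]
      change _ = (0 : (DerivedCategory.singleFunctor C 0).obj X ⟶
        ((DerivedCategory.singleFunctor C 0).obj Y)⟦(1 : ℤ)⟧)
      have h2 := congrArg ((DerivedCategory.singleFunctor C 0).map s ≫ ·) hα
      simpa [← Functor.map_comp_assoc, hs] using h2
    exact ⟨fun α β => (key α).trans (key β).symm⟩

theorem extOneVanishes_iff_retraction {X Y : C} : ExtOneVanishes X Y ↔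
    ∀ ⦃E : C⦄ (i : Y ⟶ E) (p : E ⟶ X) (w : i ≫ p = 0), (ShortComplex.mk i p w).ShortExact →
      ∃ r : E ⟶ Y, i ≫ r = 𝟙 Y := by
  rw [extOneVanishes_iff]
  refine ⟨fun h E i p w hS => ?_, fun h E i p w hS => ?_⟩
  · obtain ⟨s, hs⟩ := h i p w hS
    exact ⟨_, (ShortComplex.Splitting.ofExactOfSection _ hS.exact s hs hS.mono_f).f_r⟩
  · obtain ⟨r, hr⟩ := h i p w hS
    exact ⟨_, (ShortComplex.Splitting.ofExactOfRetraction _ hS.exact r hr hS.epi_g).s_g⟩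

end ExtOne

/-! ### Lifting properties and factorizations from Ext¹ -/

section Lifting

variable {C : Type u} [Category.{v} C] [Abelian C]

/-- Exactness from the universal property of the cokernel. -/
theorem CategoryTheory.ShortComplex.shortExact_of_desc {X Y Z : C} (f : X ⟶ Y) (g : Y ⟶ Z)
    (w : f ≫ g = 0) [Mono f] [Epi g]
    (h : ∀ {T : C} (t : Y ⟶ T), f ≫ t = 0 → ∃ t' : Z ⟶ T, g ≫ t' = t) :
    (ShortComplex.mk f g w).ShortExact where
  exact := ShortComplex.exact_of_g_is_cokernel _ <| CokernelCofork.IsColimit.ofπ' _ _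
    fun k hk => ⟨(h k hk).choose, (h k hk).choose_spec⟩

/-- A monomorphism lifts against an epimorphism whenever `Ext¹(coker, ker) = 0`. -/
theorem hasLiftingProperty_of_extOneVanishes {G F E B : C} (i : G ⟶ F) (p : E ⟶ B) [Mono i] [Epi p]
    (h : ExtOneVanishes (cokernel i) (kernel p)) : HasLiftingProperty i p := by
  refine ⟨fun {u v} sq => ?_⟩
  -- Pulling back along `v` reduces to finding a section of `p'` that extends `u'`. Dividing the
  -- pullback by `u'` leaves an extension of `cokernel i` by `kernel p`, which splits by hypothesis.
  let p' : pullback p v ⟶ F := pullback.snd p v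
  let k' : kernel p ⟶ pullback p v := pullback.lift (kernel.ι p) 0 (by simp)
  let u' : G ⟶ pullback p v := pullback.lift u i sq.w
  have k'fst : k' ≫ pullback.fst p v = kernel.ι p := pullback.lift_fst _ _ _
  have k'p' : k' ≫ p' = 0 := pullback.lift_snd _ _ _
  have u'fst : u' ≫ pullback.fst p v = u := pullback.lift_fst _ _ _
  have u'p' : u' ≫ p' = i := pullback.lift_snd _ _ _
  have mono_k' : Mono k' := mono_of_mono_fac k'fst
  have mono_u' : Mono u' := mono_of_mono_fac u'p'
  have epi_p' : Epi p' := inferInstanceAs (Epi (pullback.snd p v))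
  have desc_p' {T : C} (t : pullback p v ⟶ T) (ht : k' ≫ t = 0) : ∃ t' : F ⟶ T, p' ≫ t' = t := by
    have ex : (ShortComplex.mk k' p' k'p').Exact := by
      refine ShortComplex.exact_of_f_is_kernel _ <| KernelFork.IsLimit.ofι' _ _ fun {T} x hx =>
        ⟨kernel.lift p (x ≫ pullback.fst p v) ?_, ?_⟩
      · rw [Category.assoc, pullback.condition, ← Category.assoc]
        exact (congrArg (· ≫ v) hx).trans zero_comp
      · apply pullback.hom_ext
        · rw [Category.assoc, k'fst, kernel.lift_ι]
        · rw [Category.assoc]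
          exact ((congrArg _ k'p').trans comp_zero).trans hx.symm
    exact ⟨ex.desc t ht, ex.g_desc t ht⟩
  let g : cokernel u' ⟶ cokernel i :=
    cokernel.desc u' (p' ≫ cokernel.π i) (by rw [reassoc_of% u'p', cokernel.condition])
  have πg : cokernel.π u' ≫ g = p' ≫ cokernel.π i := cokernel.π_desc _ _ _
  have w : (k' ≫ cokernel.π u') ≫ g = 0 := by rw [Category.assoc, πg, reassoc_of% k'p', zero_comp]
  have epi_g : Epi g := epi_of_epi_fac πg
  have mono_f : Mono (k' ≫ cokernel.π u') := by
    refine Preadditive.mono_of_cancel_zero _ fun {T} x hx => ?_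
    have ex := ShortComplex.exact_kernel (cokernel.π u')
    obtain ⟨y, hy⟩ : ∃ y : T ⟶ G, y ≫ u' = x ≫ k' :=
      ⟨Abelian.monoLift u' (x ≫ k') (by simpa using hx), Abelian.monoLift_comp _ _ _⟩
    have hy0 : y = 0 := by
      rw [← cancel_mono i, zero_comp, ← u'p', reassoc_of% hy, k'p', comp_zero]
    rw [← cancel_mono k', ← hy, hy0, zero_comp, zero_comp]
  obtain ⟨r, hr⟩ := extOneVanishes_iff_retraction.1 h _ _ w <|
    ShortComplex.shortExact_of_desc _ _ w fun {T} t ht => by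
      obtain ⟨t', ht'⟩ := desc_p' (cokernel.π u' ≫ t) (by simpa using ht)
      refine ⟨cokernel.desc i t' ?_, ?_⟩
      · rw [← u'p', Category.assoc, ht', cokernel.condition_assoc, zero_comp]
      · rw [← cancel_epi (cokernel.π u'), reassoc_of% πg, cokernel.π_desc, ht']
  -- The endomorphism below kills `kernel p`, so it descends to a section `s` of `p'`; its
  -- correction term vanishes on `G`, so `i ≫ s = u'`.
  obtain ⟨s, hs⟩ := desc_p' (𝟙 _ - cokernel.π u' ≫ r ≫ k') (by
    rw [Preadditive.comp_sub, Category.comp_id, ← Category.assoc, ← Category.assoc, hr,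
      Category.id_comp, sub_self])
  refine ⟨⟨⟨s ≫ pullback.fst p v, ?_, ?_⟩⟩⟩
  · rw [← u'p', Category.assoc, reassoc_of% hs, Preadditive.sub_comp, Preadditive.comp_sub,
      Category.id_comp, Category.assoc, cokernel.condition_assoc, zero_comp, sub_zero, u'fst]
  · rw [← cancel_epi p', Category.assoc, reassoc_of% hs, Preadditive.sub_comp, Category.id_comp,
      Category.assoc, Category.assoc, pullback.condition]
    change p' ≫ v - _ ≫ _ ≫ k' ≫ p' ≫ v = _
    rw [reassoc_of% k'p', zero_comp, comp_zero, comp_zero, sub_zero]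

/-- A morphism to the target of an epimorphism lifts whenever `Ext¹(source, ker) = 0`. -/
theorem exists_lift_of_extOneVanishes {S : ShortComplex C} (hS : S.ShortExact) {M : C}
    (h : ExtOneVanishes M S.X₁) (m : M ⟶ S.X₃) : ∃ l : M ⟶ S.X₂, l ≫ S.g = m := by
  let : HasExt.{max u v} C := HasExt.standard C
  obtain ⟨s, hs⟩ := Abelian.Ext.covariant_sequence_exact₃ M hS (Abelian.Ext.mk₀ m)
    (zero_add 1) (h.elim _ _)
  obtain ⟨s, rfl⟩ := (Abelian.Ext.mk₀_bijective _ _).2 s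
  exact ⟨s, (Abelian.Ext.mk₀_bijective _ _).1 (by rw [← hs, Abelian.Ext.mk₀_comp_mk₀])⟩

/-- A morphism from the source of a monomorphism extends whenever `Ext¹(coker, target) = 0`. -/
theorem exists_extension_of_extOneVanishes {S : ShortComplex C} (hS : S.ShortExact) {M : C}
    (h : ExtOneVanishes S.X₃ M) (m : S.X₁ ⟶ M) : ∃ l : S.X₂ ⟶ M, S.f ≫ l = m := by
  let : HasExt.{max u v} C := HasExt.standard C
  obtain ⟨s, hs⟩ := Abelian.Ext.contravariant_sequence_exact₁ hS M (Abelian.Ext.mk₀ m)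
    (add_zero 1) (h.elim _ _)
  obtain ⟨s, rfl⟩ := (Abelian.Ext.mk₀_bijective _ _).2 s
  exact ⟨s, (Abelian.Ext.mk₀_bijective _ _).1 (by rw [← hs, Abelian.Ext.mk₀_comp_mk₀])⟩

theorem ExtOneVanishes.of_retract_left {M N Y : C} (h : ExtOneVanishes N Y) (r : Retract M N) :
    ExtOneVanishes M Y := by
  refine extOneVanishes_iff.2 fun E i p w hS => ?_
  obtain ⟨l, hl⟩ := exists_lift_of_extOneVanishes hS h r.r
  exact ⟨r.i ≫ l, by rw [Category.assoc]; exact (congrArg _ hl).trans r.retract⟩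

theorem ExtOneVanishes.of_retract_right {X M N : C} (h : ExtOneVanishes X N) (r : Retract M N) :
    ExtOneVanishes X M := by
  refine extOneVanishes_iff_retraction.2 fun E i p w hS => ?_
  obtain ⟨l, hl⟩ := exists_extension_of_extOneVanishes hS h r.i
  exact ⟨l ≫ r.r, by rw [← Category.assoc]; exact (congrArg (· ≫ r.r) hl).trans r.retract⟩

theorem leftPerp_of_retract {P : ObjectProperty C} {M N : C} (r : Retract M N)
    (h : leftPerp P N) : leftPerp P M :=
  fun X hX => (h X hX).of_retract_left r

theorem rightPerp_of_retract {P : ObjectProperty C} {M N : C} (r : Retract M N)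
    (h : rightPerp P N) : rightPerp P M :=
  fun X hX => (h X hX).of_retract_right r

instance (P : ObjectProperty C) : (leftPerp P).IsClosedUnderIsomorphisms where
  of_iso e h := leftPerp_of_retract (.ofIso e.symm) h

instance (P : ObjectProperty C) : (rightPerp P).IsClosedUnderIsomorphisms where
  of_iso e h := rightPerp_of_retract (.ofIso e.symm) h

/-- The monomorphisms whose cokernels satisfy `P`. -/
def monosWithCokernel (P : ObjectProperty C) : MorphismProperty C :=
  fun _ _ f => Mono f ∧ P (cokernel f)

/-- The epimorphisms whose kernels satisfy `P`. -/
def episWithKernel (P : ObjectProperty C) : MorphismProperty C :=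
  fun _ _ f => Epi f ∧ P (kernel f)

theorem monosWithCokernel_iff_of_shortExact (P : ObjectProperty C) [P.IsClosedUnderIsomorphisms]
    {S : ShortComplex C} (hS : S.ShortExact) : monosWithCokernel P S.f ↔ P S.X₃ := by
  have e := P.prop_iff_of_iso ((cokernelIsCokernel S.f).coconePointUniqueUpToIso hS.gIsCokernel)
  exact ⟨fun h => e.1 h.2, fun h => ⟨hS.mono_f, e.2 h⟩⟩

theorem episWithKernel_iff_of_shortExact (P : ObjectProperty C) [P.IsClosedUnderIsomorphisms]
    {S : ShortComplex C} (hS : S.ShortExact) : episWithKernel P S.g ↔ P S.X₁ := by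
  have e := P.prop_iff_of_iso ((kernelIsKernel S.g).conePointUniqueUpToIso hS.fIsKernel)
  exact ⟨fun h => e.1 h.2, fun h => ⟨hS.epi_g, e.2 h⟩⟩

theorem monosWithCokernel_zero_iff (P : ObjectProperty C) [P.IsClosedUnderIsomorphisms]
    {Z X : C} (hZ : IsZero Z) (f : Z ⟶ X) : monosWithCokernel P f ↔ P X := by
  have : Mono f := hZ.mono f
  have hS : (ShortComplex.mk f (𝟙 X) (hZ.eq_of_src _ _)).ShortExact :=
    ShortComplex.shortExact_of_desc _ _ _ fun t _ => ⟨t, Category.id_comp t⟩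
  exact monosWithCokernel_iff_of_shortExact P hS

theorem episWithKernel_zero_iff (P : ObjectProperty C) [P.IsClosedUnderIsomorphisms]
    {Z X : C} (hZ : IsZero Z) (f : X ⟶ Z) : episWithKernel P f ↔ P X := by
  have : Epi f := hZ.epi f
  have hS : (ShortComplex.mk (𝟙 X) f (hZ.eq_of_tgt _ _)).ShortExact :=
    ShortComplex.shortExact_of_desc _ _ _ fun t ht =>
      ⟨0, by rw [comp_zero, ← Category.id_comp t, ht]⟩
  exact episWithKernel_iff_of_shortExact P hS

/-- A monomorphism has its cokernel in `^⊥R` if and only if it has the left lifting property with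
respect to the epimorphisms with kernel in `R`. -/
theorem monosWithCokernel_leftPerp (R : ObjectProperty C) [R.IsClosedUnderIsomorphisms] :
    monosWithCokernel (leftPerp R) =
      MorphismProperty.monomorphisms C ⊓ (episWithKernel R).llp := by
  ext G F f
  refine ⟨fun ⟨hf, hc⟩ => ⟨hf, fun E B p ⟨hp, hk⟩ =>
    hasLiftingProperty_of_extOneVanishes f p (hc _ hk)⟩, fun ⟨hf, hl⟩ => ⟨hf, fun Y hY => ?_⟩⟩
  refine extOneVanishes_iff.2 fun E i p w hS => ?_
  have := hl p ((episWithKernel_iff_of_shortExact R hS).2 hY)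
  -- With zero as the top map, the lift vanishes on `G` and descends to a section over `cokernel f`.
  have sq : CommSq (0 : G ⟶ E) f p (cokernel.π f) := ⟨by simp⟩
  refine ⟨cokernel.desc f sq.lift (by simp), ?_⟩
  rw [← cancel_epi (cokernel.π f)]
  simp

section Stability

variable (R : ObjectProperty C) [R.IsClosedUnderIsomorphisms]

/-- Monomorphisms of an abelian category and left lifting classes share this stability; the same
argument serves for retracts and composition. -/
instance : (monosWithCokernel (leftPerp R)).IsStableUnderCobaseChange := by
  rw [monosWithCokernel_leftPerp]; infer_instance

instance : (monosWithCokernel (leftPerp R)).IsStableUnderRetracts := by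
  rw [monosWithCokernel_leftPerp]; infer_instance

instance : (monosWithCokernel (leftPerp R)).IsStableUnderComposition := by
  rw [monosWithCokernel_leftPerp]; infer_instance

/-- Compose 0 → X₁ → X₂, both maps being monomorphisms with cokernel in `leftPerp R`. -/
instance : (leftPerp R).IsClosedUnderExtensions where
  prop_X₂_of_shortExact {S} hS h₁ h₃ := by
    have h := (monosWithCokernel (leftPerp R)).comp_mem (0 : (0 : C) ⟶ S.X₁) S.f
      ((monosWithCokernel_zero_iff _ (isZero_zero C) _).2 h₁)
      ((monosWithCokernel_iff_of_shortExact _ hS).2 h₃)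
    exact (monosWithCokernel_zero_iff _ (isZero_zero C) _).1 h

/-- Lifts of the coprojections assemble to a section; exactness of coproducts plays no role. -/
instance (J : Type w) : (leftPerp R).IsClosedUnderColimitsOfShape (Discrete J) where
  colimitsOfShape_le := by
    rintro X ⟨h⟩ Y hY
    refine extOneVanishes_iff.2 fun E i p hw hS => ?_
    choose s hs using fun j => exists_lift_of_extOneVanishes hS (h.prop_diag_obj j Y hY) (h.ι.app j)
    refine ⟨h.isColimit.desc ⟨E, Discrete.natTrans s⟩, h.isColimit.hom_ext fun j => ?_⟩
    rw [← Category.assoc, h.isColimit.fac, Category.comp_id]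
    exact hs j

end Stability

/-- A complete cotorsion pair factorizes all morphisms. -/
theorem IsCompleteCotorsionPair.exists_factorization {P R : ObjectProperty C}
    (h : IsCompleteCotorsionPair P R) {G N : C} (f : G ⟶ N) :
    ∃ (F : C) (m : G ⟶ F) (e : F ⟶ N), m ≫ e = f ∧ monosWithCokernel P m ∧ episWithKernel R e := by
  have : R.IsClosedUnderIsomorphisms := by rw [← h.rightPerp_eq]; infer_instance
  have : P.IsClosedUnderIsomorphisms := by rw [← h.leftPerp_eq]; infer_instance
  have : (monosWithCokernel P).IsStableUnderComposition := by rw [← h.leftPerp_eq]; infer_instance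
  have : (monosWithCokernel P).IsStableUnderCobaseChange := by rw [← h.leftPerp_eq]; infer_instance
  obtain ⟨X, q, hq⟩ := h.exists_precover N
  have := hq.epi
  -- Adding a special precover of `N` makes `f` epi at the cost of cokernel `X`. Pushing out along a
  -- special preenvelope of the kernel then moves the kernel into `R`.
  let p : G ⊞ X ⟶ N := biprod.desc f q
  have epi_p : Epi p := epi_of_epi_fac (biprod.inr_desc f q)
  obtain ⟨Y, j, hj⟩ := h.exists_preenvelope (kernel p)
  have mono_j := hj.mono
  let k := kernel.ι p
  let e : pushout k j ⟶ N := pushout.desc p 0 (by simp [k])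
  have inl_e : pushout.inl k j ≫ e = p := pushout.inl_desc _ _ _
  have epi_e : Epi e := epi_of_epi_fac inl_e
  refine ⟨pushout k j, biprod.inl ≫ pushout.inl k j, e, by simp [inl_e, p], ?_, ?_⟩
  · refine (monosWithCokernel P).comp_mem _ _ ?_ ?_
    · exact (monosWithCokernel_iff_of_shortExact P
        (ShortComplex.Splitting.ofHasBinaryBiproduct G X).shortExact).2 hq.mem
    · refine (monosWithCokernel P).of_isPushout (IsPushout.of_hasPushout k j) ⟨mono_j, ?_⟩
      rw [← h.leftPerp_eq]
      exact hj.cokernel_mem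
  · have w : pushout.inr k j ≫ e = 0 := pushout.inr_desc _ _ _
    have hS : (ShortComplex.mk _ _ w).ShortExact :=
      ShortComplex.shortExact_of_desc _ _ w fun {T} t ht => by
        have ex : (ShortComplex.mk k p (kernel.condition p)).Exact := ShortComplex.exact_kernel p
        have hk : k ≫ pushout.inl k j ≫ t = 0 := by
          rw [pushout.condition_assoc, ht, comp_zero]
        refine ⟨ex.desc _ hk, pushout.hom_ext ?_ ?_⟩
        · rw [reassoc_of% inl_e]; exact ex.g_desc _ hk
        · rw [reassoc_of% w, zero_comp, ht]
    exact (episWithKernel_iff_of_shortExact R hS).2 hj.mem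

end Lifting

/-! ### Recursion along the arrows of a rooted quiver -/

section WellFounded

/-- Since `h` covers arbitrary data `d` at the predecessors, choice gives a step function for
recursion. Nothing is known about `d` beyond its type, so whatever a later step needs must be built
into `T`. -/
theorem WellFounded.exists_recursive_family {V : Type u} {r : V → V → Prop} (wf : WellFounded r)
    {T : V → Type w} (Q : ∀ i, T i → (∀ j, r j i → T j) → Prop) (h : ∀ i d, ∃ t, Q i t d) :
    ∃ D : ∀ i, T i, ∀ i, Q i (D i) fun j _ => D j := by
  choose t ht using h
  refine ⟨wf.fix t, fun i => ?_⟩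
  rw [wf.fix_eq]
  exact ht i _

variable (V : Type u) [Quiver.{v} V]

/-- By transfinite induction every vertex of each stage is accessible, because sources of arrows
into it lie in earlier stages. -/
theorem IsLeftRooted.wellFounded (h : IsLeftRooted V) :
    WellFounded fun j i : V => Nonempty (j ⟶ i) := by
  have key (α : Ordinal.{u}) : ∀ i ∈ rootedSeq V α, Acc (fun j i : V => Nonempty (j ⟶ i)) i := by
    induction α using WellFoundedLT.induction with
    | ind α ih =>
      intro i hi
      rw [rootedSeq] at hi
      rcases hi with ⟨β, rfl, hi⟩ | ⟨-, β, hβ, hi⟩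
      · refine Acc.intro i fun j ⟨a⟩ => ?_
        obtain ⟨γ, hγ, hj⟩ := hi j a
        exact ih γ (Order.lt_succ_of_le hγ) j hj
      · exact ih β hβ i hi
  obtain ⟨α, hα⟩ := h
  exact ⟨fun i => key α i (hα ▸ Set.mem_univ i)⟩

end WellFounded

/-! ### Representations by vertices and arrows; naturality of φᵢ -/

namespace QuiverRep

variable {V : Type w} [Quiver.{w} V] {A : Type u} [Category.{v} A]

/-- The representation given by objects for the vertices and morphisms for the arrows. -/
def ofArrows (F : V → A) (f : ∀ {i j : V}, (i ⟶ j) → (F i ⟶ F j)) : QuiverRep V A :=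
  Paths.lift { obj := F, map := f }

theorem ofArrows_arrow (F : V → A) (f : ∀ {i j : V}, (i ⟶ j) → (F i ⟶ F j)) {i j : V} (a : i ⟶ j) :
    (ofArrows F f).arrow a = f a :=
  Paths.lift_toPath _ a

/-- The morphism at the vertex `i`. -/
abbrev vertexMap {X Y : QuiverRep V A} (f : X ⟶ Y) (i : V) : X.vertexObj i ⟶ Y.vertexObj i :=
  f.app ((Paths.of V).obj i)

theorem arrow_vertexMap {X Y : QuiverRep V A} (f : X ⟶ Y) {i j : V} (a : i ⟶ j) :
    X.arrow a ≫ vertexMap f j = vertexMap f i ≫ Y.arrow a :=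
  f.naturality _

theorem naturality_of_arrows {X Y : QuiverRep V A} (f : ∀ i : Paths V, X.obj i ⟶ Y.obj i)
    (h : ∀ {i j : V} (a : i ⟶ j), X.arrow a ≫ f ((Paths.of V).obj j) =
      f ((Paths.of V).obj i) ≫ Y.arrow a) {i j : Paths V} (p : i ⟶ j) :
    X.map p ≫ f j = f i ≫ Y.map p := by
  induction p using Paths.induction with
  | id => rw [X.map_id, Y.map_id, Category.id_comp, Category.comp_id]
  | comp p q hp => rw [X.map_comp, Y.map_comp, Category.assoc, h, reassoc_of% hp]

/-- A morphism of representations is determined by morphisms at the vertices which are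
compatible with the arrows. -/
def homMk {X Y : QuiverRep V A} (f : ∀ i : V, X.vertexObj i ⟶ Y.vertexObj i)
    (h : ∀ {i j : V} (a : i ⟶ j), X.arrow a ≫ f j = f i ≫ Y.arrow a) : X ⟶ Y where
  app i := f i
  naturality _ _ p := naturality_of_arrows (fun i => f i) h p

theorem hom_ext {X Y : QuiverRep V A} {f g : X ⟶ Y} (h : ∀ i : V, vertexMap f i = vertexMap g i) :
    f = g :=
  NatTrans.ext (funext h)

section Phi

variable [HasCoproducts.{w} A]

theorem ι_phi (X : QuiverRep V A) {i : V} (a : Σ j : V, (j ⟶ i)) :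
    Sigma.ι (fun a : Σ j : V, (j ⟶ i) => X.vertexObj a.1) a ≫ X.phi i = X.arrow a.2 :=
  Sigma.ι_desc _ _

variable (A) in
/-- The functor `X ↦ ⨁_{a : j ⟶ i} X(j)`. -/
noncomputable def phiSource (i : V) : QuiverRep V A ⥤ A where
  obj X := ∐ fun a : Σ j : V, (j ⟶ i) => X.vertexObj a.1
  map f := Limits.Sigma.map fun a : Σ j : V, (j ⟶ i) => vertexMap f a.1
  map_id X := by
    refine Sigma.hom_ext _ _ fun a => ?_
    rw [Sigma.ι_map]
    exact (Category.id_comp _).trans (Category.comp_id _).symm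
  map_comp f g := by
    refine Sigma.hom_ext _ _ fun a => ?_
    rw [Sigma.ι_map, Sigma.ι_map_assoc, Sigma.ι_map]
    exact Category.assoc _ _ _

variable (A) in
/-- The morphisms `φᵢ` as a natural transformation. -/
noncomputable def phiNatTrans (i : V) :
    phiSource A i ⟶ (evaluation (Paths V) A).obj ((Paths.of V).obj i) where
  app X := X.phi i
  naturality X Y f := by
    refine Sigma.hom_ext _ _ fun a => ?_
    have h₁ : Sigma.ι (fun a : Σ j : V, (j ⟶ i) => X.vertexObj a.1) a ≫
        Limits.Sigma.map (fun a : Σ j : V, (j ⟶ i) => vertexMap f a.1) ≫ Y.phi i =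
          vertexMap f a.1 ≫ Y.arrow a.2 := by
      rw [Sigma.ι_map_assoc, ι_phi]
    have h₂ : Sigma.ι (fun a : Σ j : V, (j ⟶ i) => X.vertexObj a.1) a ≫
        X.phi i ≫ vertexMap f i = X.arrow a.2 ≫ vertexMap f i := by
      rw [reassoc_of% X.ι_phi]
    exact h₁.trans ((arrow_vertexMap f a.2).symm.trans h₂.symm)

end Phi

end QuiverRep

open QuiverRep

/-! ### The class Φ: orthogonality and factorization -/

section Rep

variable {V : Type w} [Quiver.{w} V] {A : Type u} [Category.{v} A] [Abelian A]

theorem shortExact_vertex {S : ShortComplex (QuiverRep V A)} (hS : S.ShortExact) (i : V) :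
    (S.map ((evaluation (Paths V) A).obj ((Paths.of V).obj i))).ShortExact :=
  hS.map_of_exact _

instance (P : ObjectProperty A) [P.IsClosedUnderIsomorphisms] :
    (monosWithCokernel P).RespectsIso := by
  refine MorphismProperty.RespectsIso.of_respects_arrow_iso _ fun f g e h => ?_
  have := h.1
  exact ⟨((MorphismProperty.monomorphisms A).arrow_iso_iff e).1 h.1,
    P.prop_of_iso (cokernel.mapIso _ _ (Arrow.leftFunc.mapIso e) (Arrow.rightFunc.mapIso e)
      e.hom.w.symm) h.2⟩

section

variable [HasCoproducts.{w} A]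

instance (P : ObjectProperty A) [P.IsClosedUnderIsomorphisms] :
    (Phi V P).IsClosedUnderIsomorphisms where
  of_iso e h i := ((monosWithCokernel P).arrow_mk_iso_iff
    (Arrow.isoMk ((phiSource A i).mapIso e) (((evaluation (Paths V) A).obj _).mapIso e)
      ((phiNatTrans A i).naturality e.hom))).1 (h i)

/-- By naturality, φᵢ of `X` is a retract of φᵢ of `Y`. -/
theorem Phi_of_retract (R : ObjectProperty A) [R.IsClosedUnderIsomorphisms] {X Y : QuiverRep V A}
    (r : Retract X Y) (h : Phi V (leftPerp R) Y) : Phi V (leftPerp R) X := fun i =>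
  MorphismProperty.of_retract (P := monosWithCokernel (leftPerp R))
    (f := X.phi i) (g := Y.phi i) (NatTrans.retractArrowApp (phiNatTrans A i) r) (h i)

/-- `Ext¹(F, R) = 0` for `F` in `Φ(P)` and `R` in `Rep(Q, P^⊥)`. -/
theorem extOneVanishes_of_Phi (wf : WellFounded fun j i : V => Nonempty (j ⟶ i))
    (P : ObjectProperty A) {F R : QuiverRep V A} (hF : Phi V P F)
    (hR : repIn V (rightPerp P) R) : ExtOneVanishes F R := by
  refine extOneVanishes_iff.2 fun E ι p w hS => ?_
  have hp (i : V) : episWithKernel (rightPerp P) (vertexMap p i) :=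
    (episWithKernel_iff_of_shortExact _ (shortExact_vertex hS i)).2 (hR i)
  obtain ⟨s, hs⟩ := wf.exists_recursive_family
    (T := fun i => { s : F.vertexObj i ⟶ E.vertexObj i // s ≫ vertexMap p i = 𝟙 _ })
    (fun i t d => ∀ (j : V) (a : j ⟶ i), F.arrow a ≫ t.1 = (d j ⟨a⟩).1 ≫ E.arrow a) <| by
      intro i d
      have := (hp i).1
      have := (hF i).1
      have := hasLiftingProperty_of_extOneVanishes (F.phi i) (vertexMap p i)
        ((hp i).2 _ (hF i).2)
      -- The top map collects the sections already chosen at the sources; commutation of the upper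
      -- triangle is compatibility with the arrows into `i`.
      have sq : CommSq (Sigma.desc fun a : Σ j : V, (j ⟶ i) => (d a.1 ⟨a.2⟩).1 ≫ E.arrow a.2)
          (F.phi i) (vertexMap p i) (𝟙 _) := by
        refine ⟨Sigma.hom_ext _ _ fun a => ?_⟩
        rw [Sigma.ι_desc_assoc, Category.assoc, arrow_vertexMap, reassoc_of% (d a.1 ⟨a.2⟩).2,
          Category.comp_id, ι_phi]
      refine ⟨⟨sq.lift, sq.fac_right⟩, fun j a => ?_⟩
      rw [← F.ι_phi ⟨j, a⟩, Category.assoc, sq.fac_left, Sigma.ι_desc]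
  exact ⟨homMk (fun i => (s i).1) fun a => hs _ _ a, QuiverRep.hom_ext fun i => (s i).2⟩

section Factorization

variable {M N : QuiverRep V A} (g : M ⟶ N)

/-- A factorization of `g` at the vertex `i`, through a monomorphism. -/
structure VertexFactorization (i : V) where
  obj : A
  left : M.vertexObj i ⟶ obj
  right : obj ⟶ N.vertexObj i
  fac : left ≫ right = vertexMap g i
  mono_left : Mono left

/-- The morphism `⨁_{a : j ⟶ i} M(j) ⟶ ⨁_{a : j ⟶ i} F(j)` induced by morphisms at the
sources of the arrows with target `i`. -/
noncomputable abbrev latchingMap (M : QuiverRep V A) (i : V) {F : ∀ j : V, (j ⟶ i) → A}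
    (f : ∀ (j : V) (a : j ⟶ i), M.vertexObj j ⟶ F j a) :
    (∐ fun a : Σ j : V, (j ⟶ i) => M.vertexObj a.1) ⟶ ∐ fun a : Σ j : V, (j ⟶ i) => F a.1 a.2 :=
  Limits.Sigma.map fun a => f a.1 a.2

/-- Relative version of the factorizations given by a complete cotorsion pair: the relative
latching morphisms of the left factor are monomorphisms with cokernel in `P`. -/
theorem exists_latching_factorization [(MorphismProperty.monomorphisms A).IsStableUnderCoproducts.{w}]
    (wf : WellFounded fun j i : V => Nonempty (j ⟶ i)) {P R : ObjectProperty A}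
    (h : IsCompleteCotorsionPair P R) :
    ∃ (F : QuiverRep V A) (α : M ⟶ F) (β : F ⟶ N), α ≫ β = g ∧ ∀ i : V,
      Mono (vertexMap α i) ∧ episWithKernel R (vertexMap β i) ∧
      ∃ m : pushout (M.phi i) (latchingMap M i fun j _ => vertexMap α j) ⟶ F.vertexObj i,
        pushout.inl _ _ ≫ m = vertexMap α i ∧ pushout.inr _ _ ≫ m = F.phi i ∧
        monosWithCokernel P m := by
  obtain ⟨D, hD⟩ := wf.exists_recursive_family (T := VertexFactorization g)
    (fun i t d => episWithKernel R t.right ∧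
      ∃ m : pushout (M.phi i) (latchingMap M i fun j a => (d j ⟨a⟩).left) ⟶ t.obj,
      pushout.inl _ _ ≫ m = t.left ∧
      (∀ (j : V) (a : j ⟶ i), Sigma.ι (fun a : Σ j : V, (j ⟶ i) => (d a.1 ⟨a.2⟩).obj) ⟨j, a⟩ ≫
        pushout.inr _ _ ≫ m ≫ t.right = (d j ⟨a⟩).right ≫ N.arrow a) ∧
      monosWithCokernel P m) <| by
    intro i d
    -- Exactness of coproducts enters here: the pushout leg `inl` is then mono, which keeps
    -- `mono_left` true at the next stage.
    have mono_latching : Mono (latchingMap M i fun j a => (d j ⟨a⟩).left) :=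
      MorphismProperty.colimMap (W := MorphismProperty.monomorphisms A) _ fun a =>
        (d a.as.1 ⟨a.as.2⟩).mono_left
    let q : pushout (M.phi i) (latchingMap M i fun j a => (d j ⟨a⟩).left) ⟶ N.vertexObj i :=
      pushout.desc (vertexMap g i)
        (Sigma.desc fun a : Σ j : V, (j ⟶ i) => (d a.1 ⟨a.2⟩).right ≫ N.arrow a.2) <| by
        refine Sigma.hom_ext _ _ fun a => ?_
        rw [reassoc_of% M.ι_phi, Sigma.ι_map_assoc, Sigma.ι_desc,
          reassoc_of% (d a.1 ⟨a.2⟩).fac, arrow_vertexMap]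
    obtain ⟨F, m, e, fac, hm, he⟩ := h.exists_factorization q
    have := hm.1
    refine ⟨⟨F, pushout.inl _ _ ≫ m, e, ?_, inferInstance⟩, he, m, rfl, fun j a => ?_, hm⟩
    · rw [Category.assoc, fac, pushout.inl_desc]
    · dsimp only
      rw [fac, pushout.inr_desc, Sigma.ι_desc]
  choose hR m hm₁ hm₂ hP using hD
  let f {j i : V} (a : j ⟶ i) : (D j).obj ⟶ (D i).obj :=
    Sigma.ι (fun a : Σ j : V, (j ⟶ i) => (D a.1).obj) ⟨j, a⟩ ≫ pushout.inr _ _ ≫ m i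
  have hf₁ {j i : V} (a : j ⟶ i) : M.arrow a ≫ (D i).left = (D j).left ≫ f a := by
    rw [← hm₁ i, ← M.ι_phi ⟨j, a⟩, Category.assoc, pushout.condition_assoc, Sigma.ι_map_assoc]
  have hf₂ {j i : V} (a : j ⟶ i) : f a ≫ (D i).right = (D j).right ≫ N.arrow a := by
    rw [← hm₂ i j a, Category.assoc, Category.assoc]
  have hf₃ (i : V) : pushout.inr (M.phi i) (latchingMap M i fun j _ => (D j).left) ≫ m i =
      Limits.Sigma.desc fun a : Σ j : V, (j ⟶ i) => f a.2 :=
    Sigma.hom_ext _ _ fun a => (Sigma.ι_desc (fun a : Σ j : V, (j ⟶ i) => f a.2) a).symm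
  let F : QuiverRep V A := ofArrows (fun i => (D i).obj) f
  have F_arrow {j i : V} (a : j ⟶ i) : F.arrow a = f a := ofArrows_arrow _ _ _
  have F_phi (i : V) : F.phi i = Limits.Sigma.desc fun a : Σ j : V, (j ⟶ i) => f a.2 :=
    congrArg Limits.Sigma.desc (funext fun a : Σ j : V, (j ⟶ i) => F_arrow a.2)
  refine ⟨F, homMk (fun i => (D i).left) fun a => (hf₁ a).trans (congrArg _ (F_arrow a).symm),
    homMk (fun i => (D i).right) fun a => (congrArg (· ≫ _) (F_arrow a)).trans (hf₂ a),
    QuiverRep.hom_ext fun i => (D i).fac, fun i => ⟨(D i).mono_left, hR i, m i, hm₁ i, ?_, hP i⟩⟩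
  exact (hf₃ i).trans (F_phi i).symm

/-- A complete cotorsion pair in `A` factorizes all morphisms of representations. -/
theorem exists_rep_factorization [(MorphismProperty.monomorphisms A).IsStableUnderCoproducts.{w}]
    (wf : WellFounded fun j i : V => Nonempty (j ⟶ i)) {P R : ObjectProperty A}
    (h : IsCompleteCotorsionPair P R) :
    ∃ (F : QuiverRep V A) (α : M ⟶ F) (β : F ⟶ N), α ≫ β = g ∧
      monosWithCokernel (Phi V P) α ∧ episWithKernel (repIn V R) β := by
  have : R.IsClosedUnderIsomorphisms := by rw [← h.rightPerp_eq]; infer_instance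
  have : (monosWithCokernel P).IsStableUnderCobaseChange := by rw [← h.leftPerp_eq]; infer_instance
  obtain ⟨F, α, β, fac, hF⟩ := exists_latching_factorization g wf h
  have mono_α : Mono α := by
    have (i : Paths V) : Mono (α.app i) := (hF i).1
    exact NatTrans.mono_of_mono_app α
  have epi_β : Epi β := by
    have (i : Paths V) : Epi (β.app i) := (hF i).2.1.1
    exact NatTrans.epi_of_epi_app β
  refine ⟨F, α, β, fac, ⟨mono_α, fun i => ?_⟩, ⟨epi_β, fun i => ?_⟩⟩
  · obtain ⟨-, -, m, hm₁, hm₂, hP⟩ := hF i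
    let C := cokernel α
    let π : F ⟶ C := cokernel.π α
    have hα : (ShortComplex.mk α π (cokernel.condition α)).ShortExact :=
      { exact := ShortComplex.exact_cokernel α }
    have epi_π (i : V) : Epi (vertexMap π i) := (shortExact_vertex hα i).epi_g
    have w (i : V) : vertexMap α i ≫ vertexMap π i = 0 :=
      congrArg (fun f => vertexMap f i) (cokernel.condition α)
    have desc (i : V) {T : A} (x : F.vertexObj i ⟶ T) (hx : vertexMap α i ≫ x = 0) :
        ∃ z : C.vertexObj i ⟶ T, vertexMap π i ≫ z = x :=
      have := (shortExact_vertex hα i).epi_g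
      ⟨(shortExact_vertex hα i).exact.desc x hx, (shortExact_vertex hα i).exact.g_desc x hx⟩
    -- Dividing out `M` turns the relative latching morphism `m` into φᵢ of the cokernel: the square
    -- formed by `p`, `m`, `C.phi i` and `vertexMap π i` is a pushout, so `C.phi i` inherits the
    -- property of `m`.
    let p : pushout (M.phi i) (latchingMap M i fun j _ => vertexMap α j) ⟶
        ∐ fun a : Σ j : V, (j ⟶ i) => C.vertexObj a.1 :=
      pushout.desc 0 (latchingMap F i fun j _ => vertexMap π j) <| by
        refine Sigma.hom_ext _ _ fun a => ?_
        rw [comp_zero, comp_zero, Sigma.ι_map_assoc, Sigma.ι_map, reassoc_of% w, zero_comp]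
    have comm : p ≫ C.phi i = m ≫ vertexMap π i := by
      apply pushout.hom_ext
      · rw [pushout.inl_desc_assoc, zero_comp, reassoc_of% hm₁, w]
      · rw [pushout.inr_desc_assoc, reassoc_of% hm₂]
        refine Sigma.hom_ext _ _ fun a => ?_
        rw [Sigma.ι_map_assoc, ι_phi, reassoc_of% F.ι_phi, arrow_vertexMap]
    have ex {T : A} (y : (∐ fun a : Σ j : V, (j ⟶ i) => C.vertexObj a.1) ⟶ T)
        (x : F.vertexObj i ⟶ T) (hxy : p ≫ y = m ≫ x) :
        ∃ z : C.vertexObj i ⟶ T, C.phi i ≫ z = y ∧ vertexMap π i ≫ z = x := by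
      obtain ⟨z, hz⟩ := desc i x (by
        rw [← hm₁, Category.assoc, ← hxy, pushout.inl_desc_assoc, zero_comp])
      refine ⟨z, Sigma.hom_ext _ _ fun a => ?_, hz⟩
      have := epi_π a.1
      rw [← cancel_epi (vertexMap π a.1), reassoc_of% C.ι_phi, ← reassoc_of% arrow_vertexMap, hz,
        ← F.ι_phi, ← hm₂, Category.assoc, Category.assoc, ← hxy, pushout.inr_desc_assoc,
        Sigma.ι_map_assoc]
    have po : IsPushout p m (C.phi i) (vertexMap π i) := ⟨⟨comm⟩, ⟨PushoutCocone.IsColimit.mk _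
      (fun s => (ex s.inl s.inr s.condition).choose)
      (fun s => (ex s.inl s.inr s.condition).choose_spec.1)
      (fun s => (ex s.inl s.inr s.condition).choose_spec.2)
      fun s z _ hz => by
        rw [← cancel_epi (vertexMap π i), hz, (ex s.inl s.inr s.condition).choose_spec.2]⟩⟩
    exact (monosWithCokernel P).of_isPushout po hP
  · have hβ : (ShortComplex.mk (kernel.ι β) β (kernel.condition β)).ShortExact :=
      { exact := ShortComplex.exact_kernel β }
    exact (episWithKernel_iff_of_shortExact R (shortExact_vertex hβ i)).1 (hF i).2.1

end Factorization

end

end Rep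

/-! ### Ext¹ and adjunctions -/

section Adjunction

variable {C D : Type*} [Category* C] [Category* D] [Abelian C] [Abelian D] {L : C ⥤ D} {G : D ⥤ C}

/-- `Ext¹(L(X), M) = 0` if `Ext¹(X, G(M)) = 0`, for an adjunction `L ⊣ G` with `G` exact. -/
theorem CategoryTheory.Adjunction.extOneVanishes_left (adj : L ⊣ G) [G.PreservesZeroMorphisms]
    [PreservesFiniteLimits G] [PreservesFiniteColimits G] {X : C} {M : D}
    (h : ExtOneVanishes X (G.obj M)) : ExtOneVanishes (L.obj X) M := by
  refine extOneVanishes_iff.2 fun E i p w hS => ?_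
  obtain ⟨l, hl⟩ : ∃ l : X ⟶ G.obj E, l ≫ G.map p = adj.unit.app X :=
    exists_lift_of_extOneVanishes (hS.map_of_exact G) h (adj.unit.app X)
  refine ⟨(adj.homEquiv _ _).symm l, (adj.homEquiv _ _).injective ?_⟩
  rw [adj.homEquiv_naturality_right, Equiv.apply_symm_apply, adj.homEquiv_id, hl]

/-- `Ext¹(X, G(M)) = 0` if `Ext¹(L(X), M) = 0`, for an adjunction `L ⊣ G` with `L` exact. -/
theorem CategoryTheory.Adjunction.extOneVanishes_right (adj : L ⊣ G) [G.PreservesZeroMorphisms]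
    [L.PreservesMonomorphisms] {X : C} {M : D} (h : ExtOneVanishes (L.obj X) M) :
    ExtOneVanishes X (G.obj M) := by
  refine extOneVanishes_iff_retraction.2 fun E i p w hS => ?_
  have mono_i : Mono i := hS.mono_f
  have epi_p : Epi p := hS.epi_g
  have : L.PreservesEpimorphisms := L.preservesEpimorphisms_of_adjunction adj
  have w' : L.map i ≫ L.map p = 0 := by
    rw [← L.map_comp, w]
    apply (adj.homEquiv _ _).injective
    rw [adj.homEquiv_unit, adj.homEquiv_unit, G.map_zero, comp_zero, ← Functor.comp_map,
      ← adj.unit.naturality, Functor.id_map, zero_comp]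
  have hS' : (ShortComplex.mk _ _ w').ShortExact :=
    ShortComplex.shortExact_of_desc _ _ _ fun {T} t ht => by
      have ht' : i ≫ adj.homEquiv _ _ t = 0 := by
        rw [← adj.homEquiv_naturality_left, ht, adj.homEquiv_unit, G.map_zero, comp_zero]
      refine ⟨(adj.homEquiv _ _).symm (hS.exact.desc _ ht'), (adj.homEquiv _ _).injective ?_⟩
      rw [adj.homEquiv_naturality_left, Equiv.apply_symm_apply]
      exact hS.exact.g_desc _ ht'
  obtain ⟨l, hl⟩ := exists_extension_of_extOneVanishes hS' h (adj.counit.app M)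
  refine ⟨adj.homEquiv _ _ l, ?_⟩
  rw [← adj.homEquiv_naturality_left]
  refine (congrArg _ hl).trans ?_
  rw [← adj.homEquiv_symm_id, Equiv.apply_symm_apply]

end Adjunction

/-! ### The equivalence for left rooted quivers -/

section CotorsionPhi

variable {V : Type w} [Quiver.{w} V] {A : Type u} [Category.{v} A]

theorem repIn_isClosedUnderIsomorphisms (R : ObjectProperty A) [R.IsClosedUnderIsomorphisms] :
    (repIn V R : ObjectProperty (QuiverRep V A)).IsClosedUnderIsomorphisms where
  of_iso e h i := R.prop_of_iso (((evaluation (Paths V) A).obj _).mapIso e) (h i)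

variable [Abelian A]

section

variable [HasCoproducts.{w} A]

/-- The value of the left adjoint at `t` is a coproduct of copies indexed by the paths from `i` to
`t`. -/
instance [(MorphismProperty.monomorphisms A).IsStableUnderCoproducts.{w}] (i : Paths V) :
    (evaluationLeftAdjoint A i).PreservesMonomorphisms where
  preserves {X Y} f hf := by
    have (t : Paths V) : Mono (((evaluationLeftAdjoint A i).map f).app t) := by
      have h : Mono (Limits.Sigma.map fun _ : i ⟶ t => f) :=
        MorphismProperty.colimMap (W := MorphismProperty.monomorphisms A) _ fun _ => hf
      have e : ((evaluationLeftAdjoint A i).map f).app t = Limits.Sigma.map fun _ : i ⟶ t => f := by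
        refine Sigma.hom_ext _ _ fun a => ?_
        exact (Sigma.ι_desc _ _).trans (Sigma.ι_map (fun _ : i ⟶ t => f) a).symm
      rw [e]
      exact h
    exact NatTrans.mono_of_mono_app _

/-- A retract of the middle term, from a splitting. -/
theorem exists_retract_of_extOneVanishes {C : Type*} [Category* C] [Abelian C]
    {F M : C} (p : F ⟶ M) [Epi p] (h : ExtOneVanishes M (kernel p)) : Nonempty (Retract M F) := by
  have hS : (ShortComplex.mk (kernel.ι p) p (kernel.condition p)).ShortExact :=
    { exact := ShortComplex.exact_kernel p }
  obtain ⟨s, hs⟩ := extOneVanishes_iff.1 h _ _ _ hS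
  exact ⟨⟨s, p, hs⟩⟩

/-- Factoring 0 → M gives an epimorphism from an object of Φ(P) with kernel in Rep(Q, R). It splits,
so `M` is a retract of that object. -/
theorem leftPerp_repIn_le_Phi [(MorphismProperty.monomorphisms A).IsStableUnderCoproducts.{w}]
    (wf : WellFounded fun j i : V => Nonempty (j ⟶ i)) {P R : ObjectProperty A}
    (h : IsCompleteCotorsionPair P R) {M : QuiverRep V A} (hM : leftPerp (repIn V R) M) :
    Phi V P M := by
  have : R.IsClosedUnderIsomorphisms := by rw [← h.rightPerp_eq]; infer_instance
  have : P.IsClosedUnderIsomorphisms := by rw [← h.leftPerp_eq]; infer_instance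
  obtain ⟨F, α, β, -, hα, hβ⟩ := exists_rep_factorization (0 : 0 ⟶ M) wf h
  have := hβ.1
  obtain ⟨r⟩ := exists_retract_of_extOneVanishes β (hM _ hβ.2)
  have hF : Phi V P F := (monosWithCokernel_zero_iff _ (isZero_zero _) α).1 hα
  obtain rfl := h.leftPerp_eq
  exact Phi_of_retract R r hF

/-- The cotorsion pair of representations induced by a complete cotorsion pair. -/
theorem IsCompleteCotorsionPair.phi [(MorphismProperty.monomorphisms A).IsStableUnderCoproducts.{w}]
    (wf : WellFounded fun j i : V => Nonempty (j ⟶ i)) {P R : ObjectProperty A}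
    (h : IsCompleteCotorsionPair P R) : IsCompleteCotorsionPair (Phi V P) (repIn V R) := by
  have : R.IsClosedUnderIsomorphisms := by rw [← h.rightPerp_eq]; infer_instance
  have : P.IsClosedUnderIsomorphisms := by rw [← h.leftPerp_eq]; infer_instance
  have := repIn_isClosedUnderIsomorphisms (V := V) R
  have ext {F M : QuiverRep V A} (hF : Phi V P F) (hM : repIn V R M) : ExtOneVanishes F M :=
    extOneVanishes_of_Phi wf P hF (by rwa [h.rightPerp_eq])
  have right : rightPerp (Phi V P) = repIn V R := by
    refine le_antisymm (fun M hM i => ?_) fun M hM F hF => ext hF hM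
    rw [← h.rightPerp_eq]
    intro X hX
    -- Test `M` against the free representation on `X` at `i`: it is left orthogonal to Rep(Q, R),
    -- hence in Φ(P), and the adjunction carries the vanishing back to M(i).
    let adj := evaluationAdjunctionRight A ((Paths.of V).obj i)
    refine adj.extOneVanishes_right (hM _ (leftPerp_repIn_le_Phi wf h fun N hN => ?_))
    refine adj.extOneVanishes_left ?_
    rw [← h.leftPerp_eq] at hX
    exact hX _ (hN i)
  have left : leftPerp (repIn V R) = Phi V P :=
    le_antisymm (fun M hM => leftPerp_repIn_le_Phi wf h hM) fun F hF M hM => ext hF hM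
  refine ⟨⟨right, left⟩, fun M => ?_, fun M => ?_⟩
  · obtain ⟨F, α, β, -, hα, hβ⟩ := exists_rep_factorization (0 : 0 ⟶ M) wf h
    exact ⟨F, β, hβ.1, (monosWithCokernel_zero_iff _ (isZero_zero _) α).1 hα, right ▸ hβ.2⟩
  · obtain ⟨F, α, β, -, hα, hβ⟩ := exists_rep_factorization (0 : M ⟶ 0) wf h
    exact ⟨F, α, hα.1, (episWithKernel_zero_iff _ (isZero_zero _) β).1 hβ, left ▸ hα.2⟩

theorem Phi.prop_of_isEmpty {P : ObjectProperty A} [P.IsClosedUnderIsomorphisms]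
    {X : QuiverRep V A} (hX : Phi V P X) {i : V} [IsEmpty (Σ j : V, (j ⟶ i))] :
    P (X.vertexObj i) :=
  (monosWithCokernel_zero_iff P
    ((IsZero.iff_id_eq_zero _).2 (Sigma.hom_ext _ _ fun a => isEmptyElim a)) _).1 (hX i)

/-- A complete cotorsion pair of representations restricts to one at a vertex without incoming
arrows. -/
theorem IsCompleteCotorsionPair.of_phi [Nonempty V]
    (wf : WellFounded fun j i : V => Nonempty (j ⟶ i)) {P : ObjectProperty A}
    [P.IsClosedUnderIsomorphisms]
    (h : IsCompleteCotorsionPair (Phi V P) (repIn V (rightPerp P))) :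
    IsCompleteCotorsionPair P (rightPerp P) := by
  obtain ⟨i, hi⟩ : ∃ i : V, IsEmpty (Σ j : V, (j ⟶ i)) := by
    obtain ⟨i, -, hi⟩ := wf.has_min Set.univ Set.univ_nonempty
    exact ⟨i, ⟨fun a => hi a.1 trivial ⟨a.2⟩⟩⟩
  have left : leftPerp (rightPerp P) = P := by
    refine le_antisymm (fun M hM => ?_) fun X hX M hM => hM X hX
    let j := (Paths.of V).obj i
    have hL : Phi V P ((evaluationLeftAdjoint A j).obj M) := by
      rw [← h.leftPerp_eq]
      exact fun N hN => (evaluationAdjunctionRight A j).extOneVanishes_left (hM _ (hN i))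
    -- Only the trivial path ends at `i`, so the free representation on `M` has value `M` at `i`.
    have path (p : Quiver.Path i i) : p = Quiver.Path.nil := by
      cases p with
      | nil => rfl
      | cons p a => exact isEmptyElim (⟨_, a⟩ : Σ j : V, (j ⟶ i))
    have u : Unique (j ⟶ j) := ⟨⟨𝟙 j⟩, path⟩
    exact P.prop_of_iso (coproductUniqueIso _) (hL.prop_of_isEmpty (i := i))
  -- Any representation with value `M` at `i` would do.
  let K (M : A) : QuiverRep V A := (Functor.const _).obj M
  refine ⟨⟨rfl, left⟩, fun M => ?_, fun M => ?_⟩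
  · obtain ⟨F, p, hp⟩ := h.exists_precover (K M)
    have := hp.epi
    have hS : (ShortComplex.mk (kernel.ι p) p (kernel.condition p)).ShortExact :=
      { exact := ShortComplex.exact_kernel p }
    have hk := hp.kernel_mem
    rw [h.rightPerp_eq] at hk
    obtain ⟨he, hk⟩ := (episWithKernel_iff_of_shortExact _ (shortExact_vertex hS i)).2 (hk i)
    exact ⟨F.vertexObj i, vertexMap p i, he, hp.mem.prop_of_isEmpty (i := i), hk⟩
  · obtain ⟨F, p, hp⟩ := h.exists_preenvelope (K M)
    have := hp.mono
    have hS : (ShortComplex.mk p (cokernel.π p) (cokernel.condition p)).ShortExact :=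
      { exact := ShortComplex.exact_cokernel p }
    have hk := hp.cokernel_mem
    rw [h.leftPerp_eq] at hk
    obtain ⟨hm, hc⟩ := (monosWithCokernel_iff_of_shortExact P (shortExact_vertex hS i)).2
      (hk.prop_of_isEmpty (i := i))
    exact ⟨F.vertexObj i, vertexMap p i, hm, hp.mem i, left.symm ▸ hc⟩

theorem isCompleteCotorsionPair_iff_phi [Nonempty V] [(MorphismProperty.monomorphisms A).IsStableUnderCoproducts.{w}] (hV : IsLeftRooted V)
    (P : ObjectProperty A) [P.IsClosedUnderIsomorphisms] :
    IsCompleteCotorsionPair P (rightPerp P) ↔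
      IsCompleteCotorsionPair (Phi V P) (repIn V (rightPerp P)) ∧
        P.IsClosedUnderExtensions ∧
          ∀ J : Type w, P.IsClosedUnderColimitsOfShape (Discrete J) := by
  refine ⟨fun h => ⟨h.phi hV.wellFounded, ?_, fun J => ?_⟩, fun h => h.1.of_phi hV.wellFounded⟩
  all_goals
    rw [← h.leftPerp_eq]
    infer_instance

end

end CotorsionPhi

/-! ### Cotorsion pairs under opposites and equivalences -/

section Transport

theorem inverseImage_functor_inj {C D : Type*} [Category* C] [Category* D] (e : C ≌ D)
    {P R : ObjectProperty D} [P.IsClosedUnderIsomorphisms] [R.IsClosedUnderIsomorphisms] :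
    P.inverseImage e.functor = R.inverseImage e.functor ↔ P = R := by
  refine ⟨fun h => ?_, fun h => h ▸ rfl⟩
  ext M
  exact (P.prop_iff_of_iso (e.counitIso.app M)).symm.trans
    ((iff_of_eq (congrFun h _)).trans (R.prop_iff_of_iso (e.counitIso.app M)))

variable {C : Type*} [Category* C] [Abelian C]

theorem extOneVanishes_op_iff {X Y : C} :
    ExtOneVanishes (op Y) (op X) ↔ ExtOneVanishes X Y := by
  rw [extOneVanishes_iff, extOneVanishes_iff_retraction]
  refine ⟨fun h E i p w hS => ?_, fun h E i p w hS => ?_⟩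
  · obtain ⟨s, hs⟩ := h p.op i.op (by rw [← op_comp, w, op_zero]) hS.op
    exact ⟨s.unop, Quiver.Hom.op_inj hs⟩
  · obtain ⟨r, hr⟩ := h p.unop i.unop (by rw [← unop_comp, w, unop_zero]) hS.unop
    exact ⟨r.op, Quiver.Hom.unop_inj hr⟩

theorem rightPerp_op (P : ObjectProperty C) : rightPerp P.op = (leftPerp P).op := by
  ext X
  exact ⟨fun h Y hY => extOneVanishes_op_iff.1 (h (op Y) hY),
    fun h Y hY => extOneVanishes_op_iff.2 (h Y.unop hY)⟩

theorem leftPerp_op (P : ObjectProperty C) : leftPerp P.op = (rightPerp P).op := by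
  ext X
  exact ⟨fun h Y hY => extOneVanishes_op_iff.1 (h (op Y) hY),
    fun h Y hY => extOneVanishes_op_iff.2 (h Y.unop hY)⟩

/-- Complete cotorsion pairs in terms of short exact sequences. -/
theorem isCompleteCotorsionPair_iff (P R : ObjectProperty C) :
    IsCompleteCotorsionPair P R ↔ (rightPerp P = R ∧ leftPerp R = P) ∧
      (∀ M : C, ∃ S : ShortComplex C, S.ShortExact ∧ Nonempty (S.X₃ ≅ M) ∧ P S.X₂ ∧ R S.X₁) ∧
      ∀ M : C, ∃ S : ShortComplex C, S.ShortExact ∧ Nonempty (S.X₁ ≅ M) ∧ R S.X₂ ∧ P S.X₃ := by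
  refine ⟨fun h => ⟨⟨h.rightPerp_eq, h.leftPerp_eq⟩, fun M => ?_, fun M => ?_⟩,
    fun ⟨⟨hR, hP⟩, hpre, henv⟩ => ⟨⟨hR, hP⟩, fun M => ?_, fun M => ?_⟩⟩
  · obtain ⟨F, f, hf⟩ := h.exists_precover M
    have := hf.epi
    exact ⟨.mk (kernel.ι f) f (kernel.condition f), { exact := ShortComplex.exact_kernel f },
      ⟨Iso.refl _⟩, hf.mem, h.rightPerp_eq ▸ hf.kernel_mem⟩
  · obtain ⟨F, f, hf⟩ := h.exists_preenvelope M
    have := hf.mono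
    exact ⟨.mk f (cokernel.π f) (cokernel.condition f), { exact := ShortComplex.exact_cokernel f },
      ⟨Iso.refl _⟩, hf.mem, h.leftPerp_eq ▸ hf.cokernel_mem⟩
  · obtain ⟨S, hS, ⟨e⟩, h₂, h₁⟩ := hpre M
    obtain rfl := hR
    have h := (episWithKernel_iff_of_shortExact _ hS).2 h₁
    have := h.1
    exact ⟨S.X₂, S.g ≫ e.hom, inferInstance, h₂,
      (rightPerp P).prop_of_iso (kernelCompMono S.g e.hom).symm h.2⟩
  · obtain ⟨S, hS, ⟨e⟩, h₂, h₃⟩ := henv M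
    obtain rfl := hP
    have h := (monosWithCokernel_iff_of_shortExact _ hS).2 h₃
    have := h.1
    exact ⟨S.X₂, e.inv ≫ S.f, inferInstance, h₂,
      (leftPerp R).prop_of_iso (cokernelEpiComp e.inv S.f).symm h.2⟩

/-- Reversing short exact sequences exchanges special precovers and preenvelopes. -/
theorem isCompleteCotorsionPair_op_iff (P R : ObjectProperty C) :
    IsCompleteCotorsionPair R.op P.op ↔ IsCompleteCotorsionPair P R := by
  rw [isCompleteCotorsionPair_iff, isCompleteCotorsionPair_iff, rightPerp_op, leftPerp_op,
    ObjectProperty.op_injective_iff, ObjectProperty.op_injective_iff]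
  refine and_congr And.comm (And.comm.trans (and_congr ⟨fun h M => ?_, fun h M => ?_⟩
    ⟨fun h M => ?_, fun h M => ?_⟩))
  · obtain ⟨S, hS, ⟨e⟩, h₂, h₁⟩ := h (op M)
    exact ⟨S.unop, hS.unop, ⟨e.unop.symm⟩, h₂, h₁⟩
  · obtain ⟨S, hS, ⟨e⟩, h₂, h₁⟩ := h M.unop
    exact ⟨S.op, hS.op, ⟨e.op.symm⟩, h₂, h₁⟩
  · obtain ⟨S, hS, ⟨e⟩, h₂, h₁⟩ := h (op M)
    exact ⟨S.unop, hS.unop, ⟨e.unop.symm⟩, h₂, h₁⟩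
  · obtain ⟨S, hS, ⟨e⟩, h₂, h₁⟩ := h M.unop
    exact ⟨S.op, hS.op, ⟨e.op.symm⟩, h₂, h₁⟩

variable {D : Type*} [Category* D] [Abelian D] (e : C ≌ D)

theorem CategoryTheory.Equivalence.extOneVanishes_iff (X : C) (M : D) :
    ExtOneVanishes (e.functor.obj X) M ↔ ExtOneVanishes X (e.inverse.obj M) :=
  ⟨e.toAdjunction.extOneVanishes_right, e.toAdjunction.extOneVanishes_left⟩

theorem rightPerp_inverseImage (P : ObjectProperty D) [P.IsClosedUnderIsomorphisms] :
    rightPerp (P.inverseImage e.functor) = (rightPerp P).inverseImage e.functor := by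
  ext X
  refine ⟨fun h M hM => ?_, fun h Z hZ => ?_⟩
  · have hM' : P (e.functor.obj (e.inverse.obj M)) := P.prop_of_iso (e.counitIso.app M).symm hM
    have := (h _ hM').of_retract_right (.ofIso (e.unitIso.app X).symm)
    exact ((e.extOneVanishes_iff _ _).2 this).of_retract_left (.ofIso (e.counitIso.app M).symm)
  · exact ((e.extOneVanishes_iff _ _).1 (h _ hZ)).of_retract_right (.ofIso (e.unitIso.app X))

theorem leftPerp_inverseImage (P : ObjectProperty D) [P.IsClosedUnderIsomorphisms] :
    leftPerp (P.inverseImage e.functor) = (leftPerp P).inverseImage e.functor := by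
  ext X
  refine ⟨fun h M hM => ?_, fun h Z hZ => ?_⟩
  · exact (e.extOneVanishes_iff _ _).2 (h _ (P.prop_of_iso (e.counitIso.app M).symm hM))
  · exact ((e.extOneVanishes_iff _ _).1 (h _ hZ)).of_retract_right (.ofIso (e.unitIso.app Z))

theorem isCompleteCotorsionPair_inverseImage_iff (P R : ObjectProperty D)
    [P.IsClosedUnderIsomorphisms] [R.IsClosedUnderIsomorphisms] :
    IsCompleteCotorsionPair (P.inverseImage e.functor) (R.inverseImage e.functor) ↔
      IsCompleteCotorsionPair P R := by
  have hc (X : D) := (e.counitIso.app X).symm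
  rw [isCompleteCotorsionPair_iff, isCompleteCotorsionPair_iff, rightPerp_inverseImage,
    leftPerp_inverseImage, inverseImage_functor_inj, inverseImage_functor_inj]
  refine and_congr Iff.rfl (and_congr ⟨fun h M => ?_, fun h M => ?_⟩
    ⟨fun h M => ?_, fun h M => ?_⟩)
  all_goals first
    | obtain ⟨S, hS, ⟨i⟩, h₂, h₁⟩ := h (e.inverse.obj M)
      exact ⟨S.map e.functor, hS.map_of_exact _, ⟨e.functor.mapIso i ≪≫ e.counitIso.app M⟩, h₂, h₁⟩
    | obtain ⟨S, hS, ⟨i⟩, h₂, h₁⟩ := h (e.functor.obj M)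
      exact ⟨S.map e.inverse, hS.map_of_exact _,
        ⟨e.inverse.mapIso i ≪≫ (e.unitIso.app M).symm⟩, P.prop_of_iso (hc _) h₂,
        R.prop_of_iso (hc _) h₁⟩
    | obtain ⟨S, hS, ⟨i⟩, h₂, h₁⟩ := h (e.functor.obj M)
      exact ⟨S.map e.inverse, hS.map_of_exact _,
        ⟨e.inverse.mapIso i ≪≫ (e.unitIso.app M).symm⟩, R.prop_of_iso (hc _) h₂,
        P.prop_of_iso (hc _) h₁⟩

end Transport

/-! ### Opposite representations -/

section OpRep

variable (V : Type w) [Quiver.{w} V] (A : Type u) [Category.{v} A]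

/-- The functor sending a representation to the opposite representation of the opposite quiver. -/
def QuiverRep.opFunctor : (QuiverRep V A)ᵒᵖ ⥤ QuiverRep Vᵒᵖ Aᵒᵖ where
  obj X := ofArrows (fun i => op (X.unop.vertexObj i.unop)) fun a => (X.unop.arrow a.unop).op
  map {X Y} f := homMk (fun i => (vertexMap f.unop i.unop).op) fun {i j} a => by
    rw [ofArrows_arrow, ofArrows_arrow]
    exact congrArg Quiver.Hom.op (arrow_vertexMap f.unop a.unop).symm
  map_id _ := QuiverRep.hom_ext fun _ => rfl
  map_comp _ _ := QuiverRep.hom_ext fun _ => rfl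

variable {V A}

theorem QuiverRep.opFunctor_arrow (X : QuiverRep V A) {i j : Vᵒᵖ} (a : i ⟶ j) :
    ((opFunctor V A).obj (op X)).arrow a = (X.arrow a.unop).op :=
  ofArrows_arrow _ _ a

instance : (opFunctor V A).Faithful where
  map_injective h := Quiver.Hom.unop_inj <| QuiverRep.hom_ext fun i =>
    Quiver.Hom.op_inj (congrArg (fun f => vertexMap f (op i)) h)

instance : (opFunctor V A).Full where
  map_surjective {X Y} f :=
    ⟨(homMk (fun i => (vertexMap f (op i)).unop) fun {i j} a => by
      have h := arrow_vertexMap f a.op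
      have h' : (X.unop.arrow a).op ≫ vertexMap f (op i) =
          vertexMap f (op j) ≫ (Y.unop.arrow a).op :=
        (congrArg (· ≫ _) (opFunctor_arrow X.unop a.op).symm).trans
          (h.trans (congrArg (_ ≫ ·) (opFunctor_arrow Y.unop a.op)))
      exact (congrArg Quiver.Hom.unop h').symm).op, QuiverRep.hom_ext fun i => rfl⟩

instance : (opFunctor V A).EssSurj where
  mem_essImage Y := by
    let X : QuiverRep V A := ofArrows (fun i => unop (Y.vertexObj (op i))) fun a =>
      (Y.arrow a.op).unop
    have hX {i j : Vᵒᵖ} (a : i ⟶ j) : ((opFunctor V A).obj (op X)).arrow a = Y.arrow a :=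
      (opFunctor_arrow X a).trans (congrArg Quiver.Hom.op (ofArrows_arrow _ _ a.unop))
    let f : (opFunctor V A).obj (op X) ⟶ Y := homMk (fun i => 𝟙 (Y.vertexObj i)) fun a =>
      (Category.comp_id _).trans ((hX a).trans (Category.id_comp _).symm)
    have (i : Paths Vᵒᵖ) : IsIso (f.app i) := inferInstanceAs (IsIso (𝟙 _))
    have : IsIso f := NatIso.isIso_of_isIso_app f
    exact ⟨op X, ⟨asIso f⟩⟩

instance : (opFunctor V A).IsEquivalence where

variable (V) in
theorem repIn_inverseImage_opFunctor (P : ObjectProperty A) :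
    (repIn Vᵒᵖ P.op).inverseImage (opFunctor V A) = (repIn V P).op := by
  ext X
  exact ⟨fun h i => h (op i), fun h i => h i.unop⟩

theorem monosWithCokernel_op_iff [Abelian A] (P : ObjectProperty A) [P.IsClosedUnderIsomorphisms]
    {X Y : A} (f : X ⟶ Y) : monosWithCokernel P.op f.op ↔ episWithKernel P f :=
  and_congr ⟨fun _ => unop_epi_of_mono f.op, fun _ => inferInstance⟩
    (P.prop_iff_of_iso (cokernelOpUnop f))

variable [HasProducts.{w} A]

/-- The source of `φ` for the opposite representation is opposite to the target of `ψ`. -/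
noncomputable def opFunctorPhiSourceIso (X : QuiverRep V A) (i : Vᵒᵖ) :
    (∐ fun a : Σ j : Vᵒᵖ, (j ⟶ i) => op (X.vertexObj a.1.unop)) ≅
      op (∏ᶜ fun a : Σ j : V, (i.unop ⟶ j) => X.vertexObj a.1) where
  hom := Sigma.desc fun a : Σ j : Vᵒᵖ, (j ⟶ i) =>
    (Pi.π (fun a : Σ j : V, (i.unop ⟶ j) => X.vertexObj a.1) ⟨a.1.unop, a.2.unop⟩).op
  inv := (Pi.lift fun a : Σ j : V, (i.unop ⟶ j) =>
    (Sigma.ι (fun a : Σ j : Vᵒᵖ, (j ⟶ i) => op (X.vertexObj a.1.unop)) ⟨op a.1, a.2.op⟩).unop).op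
  hom_inv_id := by
    refine Sigma.hom_ext _ _ fun a => ?_
    rw [Sigma.ι_desc_assoc, ← op_comp, Pi.lift_π]
    exact (Category.comp_id _).symm
  inv_hom_id := by
    refine Quiver.Hom.unop_inj (Pi.hom_ext _ _ fun a => ?_)
    rw [unop_comp, Category.assoc, Quiver.Hom.unop_op, Pi.lift_π, ← unop_comp, Sigma.ι_desc]
    exact (Category.id_comp _).symm

/-- Up to `opFunctorPhiSourceIso`, φᵢ of the opposite representation is the opposite of ψᵢ. -/
theorem Phi_inverseImage_opFunctor [Abelian A] (P : ObjectProperty A)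
    [P.IsClosedUnderIsomorphisms] :
    (Phi Vᵒᵖ P.op).inverseImage (opFunctor V A) = (Psi V P).op := by
  ext X
  have h (i : Vᵒᵖ) : monosWithCokernel P.op (((opFunctor V A).obj X).phi i) ↔
      episWithKernel P (X.unop.psi i.unop) := by
    rw [← monosWithCokernel_op_iff]
    have hphi : ((opFunctor V A).obj X).phi i = Limits.Sigma.desc fun a : Σ j : Vᵒᵖ, (j ⟶ i) =>
        (X.unop.arrow a.2.unop).op :=
      congrArg Limits.Sigma.desc (funext fun a : Σ j : Vᵒᵖ, (j ⟶ i) => opFunctor_arrow X.unop a.2)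
    refine (monosWithCokernel P.op).arrow_mk_iso_iff
      (Arrow.isoMk (opFunctorPhiSourceIso X.unop i) (Iso.refl _) ?_)
    refine Eq.trans ?_ ((Category.comp_id _).trans hphi).symm
    refine Sigma.hom_ext _ _ fun a => ?_
    refine (Sigma.ι_desc_assoc _ _ _).trans ?_
    exact (congrArg Quiver.Hom.op (Pi.lift_π (fun a : Σ j : V, (i.unop ⟶ j) => X.unop.arrow a.2)
      ⟨a.1.unop, a.2.unop⟩)).trans
        (Sigma.ι_desc (fun a : Σ j : Vᵒᵖ, (j ⟶ i) => (X.unop.arrow a.2.unop).op) a).symm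
  exact ⟨fun hX i => (h (op i)).1 (hX (op i)), fun hX i => (h i).2 (hX i.unop)⟩

end OpRep

/-! ### The equivalence for right rooted quivers -/

section Dual

variable {V : Type w} [Quiver.{w} V] {A : Type u} [Category.{v} A]

theorem epi_piMap [HasProducts.{w} A] [AB4StarOfSize.{w} A] {J : Type w} {X Y : J → A}
    (f : ∀ j, X j ⟶ Y j) [∀ j, Epi (f j)] : Epi (Limits.Pi.map f) := by
  have (j : Discrete J) : Epi ((Discrete.natTrans (F := Discrete.functor X)
      (G := Discrete.functor Y) fun j => f j.as).app j) := inferInstanceAs (Epi (f j.as))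
  have := NatTrans.epi_of_epi_app (Discrete.natTrans (F := Discrete.functor X)
    (G := Discrete.functor Y) fun j => f j.as)
  exact inferInstanceAs (Epi (lim.map (Discrete.natTrans (F := Discrete.functor X)
    (G := Discrete.functor Y) fun j => f j.as)))

/-- This is the form of exactness on which the left rooted case rests; in `Aᵒᵖ` it says that
products of epimorphisms of `A` are epi. -/
instance isStableUnderCoproducts_monomorphisms_op [HasProducts.{w} A] [AB4StarOfSize.{w} A] :
    (MorphismProperty.monomorphisms Aᵒᵖ).IsStableUnderCoproducts.{w} where
  isStableUnderCoproductsOfShape J := by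
    refine MorphismProperty.IsStableUnderCoproductsOfShape.mk _ J fun X Y _ _ f hf => ?_
    have (j : J) : Epi (f j).unop := by
      have : Mono (f j) := hf j
      infer_instance
    have := epi_piMap fun j => (f j).unop
    have h : (opProductIsoCoproduct fun j => (X j).unop).hom ≫ Limits.Sigma.map f =
        (Limits.Pi.map fun j => (f j).unop).op ≫
          (opProductIsoCoproduct fun j => (Y j).unop).hom := by
      rw [← Iso.eq_inv_comp]
      refine Limits.Sigma.hom_ext _ _ fun j => ?_
      rw [Limits.Sigma.ι_map, ← π_comp_opProductIsoCoproduct_hom (fun j => (X j).unop) j,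
        Category.assoc, Iso.hom_inv_id_assoc, ← op_comp_assoc, Limits.Pi.map_π, op_comp_assoc,
        π_comp_opProductIsoCoproduct_hom]
      rfl
    have h' := (Iso.eq_inv_comp _).2 h
    rw [MorphismProperty.monomorphisms.iff]
    exact h' ▸ inferInstance

variable [Abelian A]

theorem isClosedUnderExtensions_of_op {P : ObjectProperty A} (h : P.op.IsClosedUnderExtensions) :
    P.IsClosedUnderExtensions where
  prop_X₂_of_shortExact hS h₁ h₃ := h.prop_X₂_of_shortExact hS.op h₃ h₁

theorem isCompleteCotorsionPair_iff_psi [Nonempty V] [HasProducts.{w} A]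
    [AB4StarOfSize.{w} A] (hV : IsRightRooted V)
    (P : ObjectProperty A) [P.IsClosedUnderIsomorphisms] :
    IsCompleteCotorsionPair (leftPerp P) P ↔
      IsCompleteCotorsionPair (repIn V (leftPerp P)) (Psi V P) ∧
        P.IsClosedUnderExtensions ∧
          ∀ J : Type w, P.IsClosedUnderLimitsOfShape (Discrete J) := by
  have hA : IsCompleteCotorsionPair P.op (rightPerp P.op) ↔
      IsCompleteCotorsionPair (leftPerp P) P := by
    rw [rightPerp_op, isCompleteCotorsionPair_op_iff]
  have hR : IsCompleteCotorsionPair (Phi Vᵒᵖ P.op) (repIn Vᵒᵖ (rightPerp P.op)) ↔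
      IsCompleteCotorsionPair (repIn V (leftPerp P)) (Psi V P) := by
    have := repIn_isClosedUnderIsomorphisms (V := Vᵒᵖ) (rightPerp P.op)
    refine Iff.trans ?_ (isCompleteCotorsionPair_op_iff (repIn V (leftPerp P)) (Psi V P))
    rw [← Phi_inverseImage_opFunctor, ← repIn_inverseImage_opFunctor, ← rightPerp_op]
    exact (isCompleteCotorsionPair_inverseImage_iff (opFunctor V A).asEquivalence _ _).symm
  have h := isCompleteCotorsionPair_iff_phi (V := Vᵒᵖ) hV P.op
  rw [hA, hR] at h
  refine ⟨fun hP => ?_, fun hP => hA.1 ((hR.2 hP.1).of_phi hV.wellFounded)⟩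
  obtain ⟨h₁, h₂, h₃⟩ := h.1 hP
  refine ⟨h₁, isClosedUnderExtensions_of_op h₂, fun J => ?_⟩
  -- Dualizing yields limits over `(Discrete J)ᵒᵖ`, which is equivalent to `Discrete J`.
  have := (ObjectProperty.isClosedUnderLimitsOfShape_op_iff_op P (Discrete J)).2 (h₃ J)
  exact ObjectProperty.IsClosedUnderLimitsOfShape.of_equivalence (Discrete.opposite J)

end Dual

theorem mainTheorem4 {A : Type u} [Category.{v} A] [Abelian A]
    (V : Type w) [Quiver.{w} V] [Nonempty V]
    (X : ObjectProperty A) [X.IsClosedUnderIsomorphisms] [X.IsClosedUnderFiniteCoproducts] :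
    (∀ [HasCoproducts.{w} A] [AB4OfSize.{w} A], IsLeftRooted V →
      (IsCompleteCotorsionPair X (rightPerp X) ↔
        IsCompleteCotorsionPair (Phi V X) (repIn V (rightPerp X)) ∧
          X.IsClosedUnderExtensions ∧
          ∀ J : Type w, X.IsClosedUnderColimitsOfShape (Discrete J))) ∧
    (∀ [HasProducts.{w} A] [AB4StarOfSize.{w} A], IsRightRooted V →
      (IsCompleteCotorsionPair (leftPerp X) X ↔
        IsCompleteCotorsionPair (repIn V (leftPerp X)) (Psi V X) ∧
          X.IsClosedUnderExtensions ∧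
          ∀ J : Type w, X.IsClosedUnderLimitsOfShape (Discrete J))) :=
  ⟨fun hV => isCompleteCotorsionPair_iff_phi hV X, fun hV => isCompleteCotorsionPair_iff_psi hV X⟩
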